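/- A symmetric quasi-Cartan matrix is a symmetric integer matrix $A\in\mathcal M_n(\mathbb Z)$ with $A_{ii}=2$ for all $i$. Its bigraph $\mathbf G_A$ is the graph with vertex set $\{1,\dots,n\}$ having, for each pair $i\neq j$, exactly $|A_{ij}|$ parallel edges with endpoints $i,j$, all of them dotted if $A_{ij}>0$ and all of them solid if $A_{ij}<0$. The bigraph $G=\mathbf G_A$ is said to have Dynkin type $\mathbb A_n$ if there is an integer matrix $M\in\mathcal M_n(\mathbb Z)$ with $M^{-1}\in\mathcal M_n(\mathbb Z)$ such that $M^{\mathrm T}AM$ is the Cartan matrix of type $\mathbb A_n$ (the matrix with $2$ on the diagonal, $-1$ at the positions $(i,j)$ with $|i-j|=1$, and $0$ elsewhere). A separation vertex of a graph is a vertex $s$ such that some two other vertices are joined by a path in the graph but not after the removal of $s$. A block is a maximal nonseparable subgraph, where nonseparable means nonempty, connected and without separation vertices of its own (so an isolated vertex is a block). The block tree $\mathrm{BT}(G)$ is the bipartite graph whose vertices are the blocks and the separation vertices of $G$, a block $B$ and a separation vertex $s$ being adjacent when $s\in V(B)$. For disjoint finite sets $X,Y$ (one of which may be empty), $\mathbf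 F[X,Y]$ is the bigraph with vertex set $X\cup Y$ having a single solid edge between each $x\in X$ and each $y\in Y$, a single dotted edge between any two distinct vertices of $X$ and between any two distinct vertices of $Y$, and no other edges. $\mathrm{BT}(G)$ is called an $\mathbb A$-block tree if it is a tree, every block of $G$ equals $\mathbf F[X,Y]$ for some disjoint $X,Y$, and every separation vertex of $G$ has degree $2$ in $\mathrm{BT}(G)$, i.e. lies in exactly two blocks. **Theorem.** Let $n\ge1$ and let $G$ be the bigraph of a symmetric quasi-Cartan matrix of size $n$. Then $G$ has Dynkin type $\mathbb A_n$ if and only if $\mathrm{BT}(G)$ is an $\mathbb A$-block tree. -/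

import Mathlib

/-- A symmetric quasi-Cartan matrix: a symmetric integer matrix all of whose diagonal entries
are `2`. -/
def IsQuasiCartan {V : Type*} (A : Matrix V V ℤ) : Prop :=
  A.IsSymm ∧ ∀ i, A i i = 2

/-- `A` and `A'` are `ℤ`-equivalent if `A' = Mᵀ A M` for some integer matrix `M` having an integer
inverse. -/
def ZEquivalent {V : Type*} [Fintype V] [DecidableEq V] (A A' : Matrix V V ℤ) : Prop :=
  ∃ M : Matrix V V ℤ, IsUnit M ∧ A' = M.transpose * A * M

/-- A bigraph on the vertex set `V`: a loopless graph, parallel edges allowed, whose edges are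
solid or dotted, parallel edges having the same line style. It is recorded by the numbers
`solid i j` and `dotted i j` of solid and of dotted edges with endpoints `i` and `j`. -/
@[ext]
structure Bigraph (V : Type*) where
  solid : V → V → ℕ
  dotted : V → V → ℕ
  solid_symm : ∀ i j, solid i j = solid j i
  dotted_symm : ∀ i j, dotted i j = dotted j i
  solid_loopless : ∀ i, solid i i = 0
  dotted_loopless : ∀ i, dotted i i = 0
  one_style : ∀ i j, solid i j = 0 ∨ dotted i j = 0

namespace Bigraph

/-- The bigraph of a symmetric quasi-Cartan matrix `A`: for `i ≠ j` there are `|A i j|` edges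
between `i` and `j`, dotted if `A i j > 0` and solid if `A i j < 0`. -/
def ofMatrix {V : Type*} [DecidableEq V] (A : Matrix V V ℤ) (hA : IsQuasiCartan A) :
    Bigraph V where
  solid i j := if i = j then 0 else (-A i j).toNat
  dotted i j := if i = j then 0 else (A i j).toNat
  solid_symm i j := by simp only [eq_comm (a := i), hA.1.apply i j]
  dotted_symm i j := by simp only [eq_comm (a := i), hA.1.apply i j]
  solid_loopless i := by simp
  dotted_loopless i := by simp
  one_style i j := by split_ifs <;> omega

/-- The symmetric quasi-Cartan matrix of a bigraph. -/
def toMatrix {V : Type*} [DecidableEq V] (G : Bigraph V) : Matrix V V ℤ :=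
  Matrix.of fun i j => if i = j then 2 else (G.dotted i j : ℤ) - (G.solid i j : ℤ)

theorem isQuasiCartan_toMatrix {V : Type*} [DecidableEq V] (G : Bigraph V) :
    IsQuasiCartan G.toMatrix := by
  refine ⟨Matrix.IsSymm.ext fun i j => ?_, fun i => by simp [toMatrix]⟩
  simp [toMatrix, eq_comm (a := i), G.solid_symm i j, G.dotted_symm i j]

theorem toMatrix_ofMatrix {V : Type*} [DecidableEq V] (A : Matrix V V ℤ)
    (hA : IsQuasiCartan A) : (ofMatrix A hA).toMatrix = A := by
  ext i j
  by_cases h : i = j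
  · subst h
    simp [toMatrix, hA.2]
  · simp only [toMatrix, ofMatrix, Matrix.of_apply, h, if_false]
    omega

theorem ofMatrix_toMatrix {V : Type*} [DecidableEq V] (G : Bigraph V) :
    ofMatrix G.toMatrix G.isQuasiCartan_toMatrix = G := by
  ext i j
  · by_cases h : i = j
    · subst h
      simp [ofMatrix, G.solid_loopless]
    · have := G.one_style i j
      simp only [toMatrix, ofMatrix, Matrix.of_apply, h, if_false]
      omega
  · by_cases h : i = j
    · subst h
      simp [ofMatrix, G.dotted_loopless]
    · have := G.one_style i j
      simp only [toMatrix, ofMatrix, Matrix.of_apply, h, if_false]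
      omega

/-- `G` has the Dynkin type of the Cartan matrix `B` if the quasi-Cartan matrix of `G` is
`ℤ`-equivalent to `B`. -/
def HasDynkinType {V : Type*} [Fintype V] [DecidableEq V] (G : Bigraph V)
    (B : Matrix V V ℤ) : Prop :=
  ZEquivalent G.toMatrix B

/-- The simple graph underlying a bigraph: line styles and multiplicities are forgotten. -/
def graph {V : Type*} (G : Bigraph V) : SimpleGraph V where
  Adj i j := G.solid i j ≠ 0 ∨ G.dotted i j ≠ 0
  symm := ⟨fun i j h => by rwa [G.solid_symm j i, G.dotted_symm j i]⟩
  loopless := ⟨fun i h => by simp [G.solid_loopless, G.dotted_loopless] at h⟩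

/-- The sub-bigraph induced by a set of vertices. -/
def induce {V : Type*} (G : Bigraph V) (B : Set V) : Bigraph B where
  solid i j := G.solid i j
  dotted i j := G.dotted i j
  solid_symm i j := G.solid_symm i j
  dotted_symm i j := G.dotted_symm i j
  solid_loopless i := G.solid_loopless i
  dotted_loopless i := G.dotted_loopless i
  one_style i j := G.one_style i j

open Classical in
/-- The complete bigraph `F[X, Y]`, with vertex set the disjoint union of `X` and `Y`: one solid
edge between each `x ∈ X` and each `y ∈ Y`, one dotted edge between any two distinct vertices of
`X` and between any two distinct vertices of `Y`. One of `X` and `Y` may be empty. -/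
noncomputable def complete {W : Type*} (X Y : Set W) (h : IsCompl X Y) : Bigraph W where
  solid i j := if (i ∈ X ∧ j ∈ Y) ∨ (i ∈ Y ∧ j ∈ X) then 1 else 0
  dotted i j := if i ≠ j ∧ ((i ∈ X ∧ j ∈ X) ∨ (i ∈ Y ∧ j ∈ Y)) then 1 else 0
  solid_symm i j := by
    refine if_congr ?_ rfl rfl
    tauto
  dotted_symm i j := by
    refine if_congr ?_ rfl rfl
    rw [ne_comm]
    tauto
  solid_loopless i := by
    have : i ∈ X → i ∉ Y := fun hX hY => Set.disjoint_left.1 h.disjoint hX hY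
    rw [if_neg]
    tauto
  dotted_loopless i := by simp
  one_style i j := by
    have hi : i ∈ X → i ∉ Y := fun hX hY => Set.disjoint_left.1 h.disjoint hX hY
    have hj : j ∈ X → j ∉ Y := fun hX hY => Set.disjoint_left.1 h.disjoint hX hY
    by_cases hs : (i ∈ X ∧ j ∈ Y) ∨ (i ∈ Y ∧ j ∈ X)
    · right
      rw [if_neg]
      tauto
    · left
      rw [if_neg hs]

end Bigraph

/-- `s` is a separation vertex of the graph `H`: some two other vertices are joined by a path in
`H`, but not in the graph obtained from `H` by removing `s`. -/
def IsSeparationVertex {V : Type*} (H : SimpleGraph V) (s : V) : Prop :=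
  ∃ u v : ({s}ᶜ : Set V), H.Reachable u v ∧ ¬ (H.induce ({s}ᶜ : Set V)).Reachable u v

/-- A graph is nonseparable if it is connected (in particular nonempty) and has no separation
vertex. -/
def IsNonseparable {V : Type*} (H : SimpleGraph V) : Prop :=
  H.Connected ∧ ∀ s, ¬ IsSeparationVertex H s

/-- `B` is the vertex set of a block of `H`, i.e. of a maximal nonseparable subgraph. As a maximal
nonseparable subgraph is an induced subgraph, it is enough to consider sets of vertices. -/
def IsBlock {V : Type*} (H : SimpleGraph V) (B : Set V) : Prop :=
  Maximal (fun C : Set V => IsNonseparable (H.induce C)) B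

/-- The block tree of `H`: the bipartite graph whose vertices are the blocks and the separation
vertices of `H`, with an edge between `B` and `s` whenever `s` is a vertex of `B`. -/
def blockTree {V : Type*} (H : SimpleGraph V) :
    SimpleGraph ({B : Set V // IsBlock H B} ⊕ {s : V // IsSeparationVertex H s}) where
  Adj
    | .inl B, .inr s => s.1 ∈ B.1
    | .inr s, .inl B => s.1 ∈ B.1
    | _, _ => False
  symm := ⟨by rintro (B | s) (C | t) h <;> exact h⟩
  loopless := ⟨by rintro (B | s) h <;> exact h⟩

/-- The block tree of the bigraph `G` is an `𝔸`-block tree: it is a tree, each block of `G` is some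
`F[X, Y]`, and each separation vertex of `G` has degree `2` in the block tree. -/
def Bigraph.IsABlockTree {V : Type*} (G : Bigraph V) : Prop :=
  (blockTree G.graph).IsTree ∧
  (∀ B : Set V, IsBlock G.graph B →
    ∃ (X Y : Set B) (h : IsCompl X Y), G.induce B = Bigraph.complete X Y h) ∧
  (∀ s : {s : V // IsSeparationVertex G.graph s},
    ((blockTree G.graph).neighborSet (Sum.inr s)).ncard = 2)

/-! The lattice of type $\mathbb A_n$ is the lattice of sum-zero vectors in $\mathbb Z^{n+1}$, and
its vectors of squared length 2 are the $e_a-e_b$. A basis of such vectors is an oriented graph with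
$n$ edges on $n+1$ vertices, and generating the lattice means that this graph is connected, i.e. a
tree. So $G$ has type $\mathbb A_n$ exactly when it is the signed line graph of an oriented tree:
`Bigraph.HasDynkinType.nonempty_treeModel` and `Bigraph.hasDynkinType_of_connects`.

For such a line graph the functional `f i`, which jumps only across the tree edge `i`, does the work
of cutting the tree. It shows that nonseparable sets lie in stars of tree vertices
(`TreeModel.exists_subset_star`) and that every edge of the block tree is a bridge
(`TreeModel.isAcyclic`). In the star of `p`, the parts $X,Y$ are the edges with head, respectively
tail, at `p`.

Conversely, the blocks of $G$, together with a leaf for each vertex that is not a separation vertex,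
are the vertices of a tree whose edges are the vertices of $G$. Each block prescribes the signs of
its edges up to a common sign; these choices can be made compatible because every sign cochain on a
tree is a coboundary (`Bigraph.IsABlockTree.exists_connects`). -/

open Matrix

/-! ### Incidence matrices of oriented graphs -/

/-- The vertex-edge incidence matrix of the oriented graph with edges `i` from `t i` to `h i`. -/
def edgeMatrix {P V : Type*} [DecidableEq P] (h t : V → P) : Matrix P V ℤ :=
  Matrix.of fun p i => (if p = h i then 1 else 0) - (if p = t i then 1 else 0)

/-- The edges `(h i, t i)` connect the vertex set `P`. -/
def Connects {P V : Type*} (h t : V → P) : Prop :=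
  ∀ r : P → P → Prop, Equivalence r → (∀ i, r (h i) (t i)) → ∀ p q, r p q

/-- The inner product of the roots `e (h i) - e (t i)` and `e (h j) - e (t j)`. -/
def edgeInner {P V : Type*} [DecidableEq P] (h t : V → P) (i j : V) : ℤ :=
  (if h i = h j then 1 else 0) - (if h i = t j then 1 else 0)
    - ((if t i = h j then 1 else 0) - (if t i = t j then 1 else 0))

theorem Connects.comp_equiv {P Q V : Type*} {h t : V → P} (hc : Connects h t) (e : P ≃ Q) :
    Connects (e ∘ h) (e ∘ t) := by
  intro r hr hi p q
  have := hc (fun a b => r (e a) (e b)) ⟨fun _ => hr.refl _, hr.symm, hr.trans⟩ hi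
    (e.symm p) (e.symm q)
  simpa using this

section EdgeMatrix

variable {P V : Type*} [DecidableEq P]

theorem vecMul_edgeMatrix [Fintype P] (h t : V → P) (φ : P → ℤ) (i : V) :
    (φ ᵥ* edgeMatrix h t) i = φ (h i) - φ (t i) := by
  simp [vecMul, dotProduct, edgeMatrix, mul_sub, Finset.sum_sub_distrib]

theorem mul_edgeMatrix_apply [Fintype P] {W : Type*} (F : Matrix W P ℤ) (h t : V → P) (w : W)
    (i : V) : (F * edgeMatrix h t) w i = F w (h i) - F w (t i) := by
  rw [← vecMul_edgeMatrix h t (F w)]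
  rfl

theorem transpose_edgeMatrix_mul [Fintype P] (h t : V → P) (i j : V) :
    ((edgeMatrix h t)ᵀ * edgeMatrix h t) i j = edgeInner h t i j := by
  rw [mul_edgeMatrix_apply]
  simp only [transpose_apply, edgeMatrix, of_apply, edgeInner, eq_comm (a := h i),
    eq_comm (a := t i)]
  ring

/-- The pairs $(p,q)$ for which $e_p-e_q$ is an integer combination of edge vectors form an
equivalence relation containing the edges, hence all pairs. -/
theorem Connects.exists_edgeMatrix_eq_mul [Fintype V] {W : Type*} {h t : V → P}
    (hc : Connects h t) (h' t' : W → P) :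
    ∃ M : Matrix V W ℤ, edgeMatrix h' t' = edgeMatrix h t * M := by
  have key : ∀ p q : P, ∃ c : V → ℤ, ∀ a : P,
      ((if a = p then 1 else 0) - (if a = q then 1 else 0) : ℤ) = (edgeMatrix h t *ᵥ c) a := by
    classical
    refine hc _ ⟨fun p => ⟨0, fun a => by simp⟩, ?_, ?_⟩ ?_
    · rintro p q ⟨c, hc⟩
      exact ⟨-c, fun a => by rw [mulVec_neg, Pi.neg_apply, ← hc]; ring⟩
    · rintro p q s ⟨c, hc⟩ ⟨d, hd⟩
      exact ⟨c + d, fun a => by rw [mulVec_add, Pi.add_apply, ← hc, ← hd]; ring⟩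
    · intro i
      exact ⟨Pi.single i 1, fun a => by simp [edgeMatrix]⟩
  choose c hc using key
  refine ⟨Matrix.of fun i w => c (h' w) (t' w) i, ?_⟩
  ext a w
  exact hc (h' w) (t' w) a

/-- A nonzero sum-zero vector has a positive and a negative entry, and these two already use up
squared length 2. -/
theorem exists_edge_of_sum_eq_zero [Fintype P] (x : P → ℤ) (h0 : ∑ p, x p = 0)
    (h2 : ∑ p, x p * x p = 2) :
    ∃ a b : P, ∀ p, x p = (if p = a then 1 else 0) - (if p = b then 1 else 0) := by
  have hx : ∃ p ∈ Finset.univ, x p ≠ 0 := by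
    by_contra! hx
    rw [Finset.sum_eq_zero (fun p hp => by simp [hx p hp])] at h2
    omega
  obtain ⟨a, -, ha⟩ := Finset.exists_pos_of_sum_zero_of_exists_nonzero x h0 hx
  obtain ⟨b, -, hb⟩ := Finset.exists_pos_of_sum_zero_of_exists_nonzero (fun p => - x p)
    (s := Finset.univ) (by simp [h0]) (by simpa using hx)
  have hab : a ≠ b := by rintro rfl; omega
  have hsplit : x a * x a + (x b * x b + ∑ p ∈ (Finset.univ.erase a).erase b, x p * x p) = 2 := by
    rw [Finset.add_sum_erase _ (fun p => x p * x p) (by simp [hab.symm]),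
      Finset.add_sum_erase _ (fun p => x p * x p) (by simp), h2]
  have hnn : 0 ≤ ∑ p ∈ (Finset.univ.erase a).erase b, x p * x p :=
    Finset.sum_nonneg fun p _ => mul_self_nonneg _
  have ha1 : x a = 1 := by nlinarith
  have hb1 : x b = -1 := by nlinarith
  have hrest : ∑ p ∈ (Finset.univ.erase a).erase b, x p * x p = 0 := by
    rw [ha1, hb1] at hsplit
    omega
  rw [Finset.sum_eq_zero_iff_of_nonneg fun p _ => mul_self_nonneg _] at hrest
  refine ⟨a, b, fun p => ?_⟩
  by_cases hpa : p = a
  · subst hpa; simp [ha1, hab]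
  by_cases hpb : p = b
  · subst hpb; simp [hb1, hpa]
  simpa [hpa, hpb] using hrest p (by simp [hpa, hpb])

end EdgeMatrix

/-! ### The path and the Cartan matrix of type A -/

section Path

/-- The incidence matrix of the path with `n` edges. -/
abbrev pathMatrix (n : ℕ) : Matrix (Fin (n + 1)) (Fin n) ℤ :=
  edgeMatrix Fin.castSucc Fin.succ

/-- The partial-sum matrix, a left inverse of `pathMatrix n`. -/
def partialSumMatrix (n : ℕ) : Matrix (Fin n) (Fin (n + 1)) ℤ :=
  Matrix.of fun k j => if j ≤ k.castSucc then 1 else 0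

theorem partialSumMatrix_mul_pathMatrix (n : ℕ) : partialSumMatrix n * pathMatrix n = 1 := by
  ext k i
  rw [mul_edgeMatrix_apply, one_apply]
  simp only [partialSumMatrix, of_apply, Fin.le_def, Fin.ext_iff, Fin.val_castSucc, Fin.val_succ]
  split_ifs <;> omega

theorem transpose_pathMatrix_mul (n : ℕ) :
    (pathMatrix n)ᵀ * pathMatrix n = CartanMatrix.A n := by
  ext i j
  rw [transpose_edgeMatrix_mul]
  simp only [edgeInner, CartanMatrix.A, of_apply, Fin.ext_iff, Fin.val_castSucc, Fin.val_succ]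
  split_ifs <;> omega

theorem connects_path (n : ℕ) : Connects (Fin.castSucc : Fin n → Fin (n + 1)) Fin.succ := by
  intro r hr hi
  have h0 : ∀ p, r 0 p := fun p => Fin.induction (hr.refl _) (fun i h => hr.trans h (hi i)) p
  exact fun p q => hr.trans (hr.symm (h0 p)) (h0 q)

end Path

/-! ### Type A and oriented trees -/

/-- The bigraph `G` is the signed line graph of the oriented tree on `P` whose edges are
`(h i, t i)`, for the vertices `i` of `G`; `f i` separates the two sides of the edge `i`. -/
structure TreeModel {V : Type*} [DecidableEq V] (G : Bigraph V) (P : Type*) [DecidableEq P] where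
  h : V → P
  t : V → P
  f : V → P → ℤ
  connects : Connects h t
  cut : ∀ i j, f i (h j) - f i (t j) = if i = j then 1 else 0
  toMatrix_eq : ∀ i j, G.toMatrix i j = edgeInner h t i j

theorem Bigraph.HasDynkinType.nonempty_treeModel {n : ℕ} {G : Bigraph (Fin n)}
    (hG : G.HasDynkinType (CartanMatrix.A n)) : Nonempty (TreeModel G (Fin (n + 1))) := by
  obtain ⟨M, ⟨u, rfl⟩, hM⟩ := hG
  set N : Matrix (Fin n) (Fin n) ℤ := ↑u⁻¹
  set M : Matrix (Fin n) (Fin n) ℤ := ↑u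
  have hNM : N * M = 1 := u.inv_mul
  have hMN : M * N = 1 := u.mul_inv
  have hA : G.toMatrix = (pathMatrix n * N)ᵀ * (pathMatrix n * N) := by
    have : (pathMatrix n * N)ᵀ * (pathMatrix n * N) = Nᵀ * (Mᵀ * G.toMatrix * M) * N := by
      rw [← hM, ← transpose_pathMatrix_mul, transpose_mul]
      simp only [Matrix.mul_assoc]
    rw [this]
    calc G.toMatrix = (M * N)ᵀ * G.toMatrix * (M * N) := by simp [hMN]
      _ = _ := by rw [transpose_mul]; simp only [Matrix.mul_assoc]
  have hroot : ∀ i, ∃ a b : Fin (n + 1), ∀ p, (pathMatrix n * N) p i =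
      (if p = a then 1 else 0) - (if p = b then 1 else 0) := by
    intro i
    apply exists_edge_of_sum_eq_zero
    · have h1 : (fun _ => 1) ᵥ* (pathMatrix n) = 0 := by
        ext j
        rw [vecMul_edgeMatrix]
        simp
      have h2 : ((fun _ => 1) ᵥ* (pathMatrix n * N)) i = 0 := by
        rw [← vecMul_vecMul, h1]
        simp
      simpa [vecMul, dotProduct] using h2
    · have h1 := congrFun (congrFun hA i) i
      rw [G.isQuasiCartan_toMatrix.2] at h1
      rw [h1, mul_apply]
      rfl
  choose h t hht using hroot
  have hv : pathMatrix n * N = edgeMatrix h t := by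
    ext p i
    exact hht i p
  -- The functionals `f i` are the rows of a left inverse of the edge matrix `pathMatrix n * N`.
  refine ⟨⟨h, t, M * partialSumMatrix n, ?_, ?_, ?_⟩⟩
  · intro r hr hi p q
    classical
    -- The indicator of the class of `q` vanishes on all edge vectors, hence on the path vectors
    -- they generate, so it is constant.
    let φ : Fin (n + 1) → ℤ := fun a => if r a q then 1 else 0
    have h1 : φ ᵥ* edgeMatrix h t = 0 := by
      ext i
      rw [vecMul_edgeMatrix]
      have : r (h i) q ↔ r (t i) q := ⟨hr.trans (hr.symm (hi i)), hr.trans (hi i)⟩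
      simp [φ, this]
    have h2 : φ ᵥ* pathMatrix n = 0 := by
      calc φ ᵥ* pathMatrix n = φ ᵥ* (pathMatrix n * N * M) := by
            rw [Matrix.mul_assoc, hNM, Matrix.mul_one]
        _ = 0 := by rw [hv, ← vecMul_vecMul, h1, zero_vecMul]
    have h3 : φ p = φ q := by
      refine connects_path n (fun a b => φ a = φ b) ⟨fun _ => rfl, Eq.symm, Eq.trans⟩ ?_ p q
      intro i
      have := congrFun h2 i
      rw [vecMul_edgeMatrix] at this
      exact sub_eq_zero.1 this
    by_contra hpq
    simp [φ, hpq, hr.refl] at h3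
  · intro i j
    rw [← mul_edgeMatrix_apply, ← hv, Matrix.mul_assoc, ← Matrix.mul_assoc (partialSumMatrix n),
      partialSumMatrix_mul_pathMatrix, Matrix.one_mul, hMN, one_apply]
  · intro i j
    rw [hA, hv, transpose_edgeMatrix_mul]

/-- The edges of either connected graph generate those of the other, so the two transition matrices
are integral; they are mutually inverse because the path vectors are independent and the matrices
are square. Acyclicity need not be assumed: it follows from the count of $n$ edges on $n+1$
vertices. -/
theorem Bigraph.hasDynkinType_of_connects {n : ℕ} {G : Bigraph (Fin n)}
    {h t : Fin n → Fin (n + 1)} (hc : Connects h t)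
    (hG : ∀ i j, G.toMatrix i j = edgeInner h t i j) : G.HasDynkinType (CartanMatrix.A n) := by
  obtain ⟨M, hM⟩ := hc.exists_edgeMatrix_eq_mul Fin.castSucc Fin.succ
  obtain ⟨N, hN⟩ := (connects_path n).exists_edgeMatrix_eq_mul h t
  have hNM : N * M = 1 := by
    have h1 : partialSumMatrix n * (pathMatrix n * N * M) = N * M := by
      rw [Matrix.mul_assoc, ← Matrix.mul_assoc, partialSumMatrix_mul_pathMatrix, Matrix.one_mul]
    rw [← h1, ← hN, ← hM, partialSumMatrix_mul_pathMatrix]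
  refine ⟨M, ⟨⟨M, N, mul_eq_one_comm.1 hNM, hNM⟩, rfl⟩, ?_⟩
  have hA : G.toMatrix = (edgeMatrix h t)ᵀ * edgeMatrix h t := by
    ext i j
    rw [transpose_edgeMatrix_mul, hG]
  rw [← transpose_pathMatrix_mul, hA, pathMatrix, hM, transpose_mul]
  simp only [Matrix.mul_assoc]

/-! ### Walks in induced subgraphs -/

theorem SimpleGraph.Reachable.apply_eq {V α : Type*} {H : SimpleGraph V} {φ : V → α}
    (hφ : ∀ u v, H.Adj u v → φ u = φ v) {u v : V} (h : H.Reachable u v) : φ u = φ v := by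
  obtain ⟨p⟩ := h
  induction p with
  | nil => rfl
  | cons a _ ih => exact (hφ _ _ a).trans ih

theorem SimpleGraph.Walk.exists_walk_of_induce {V : Type*} {H : SimpleGraph V} {C : Set V} {a b : C}
    (p : (H.induce C).Walk a b) :
    ∃ q : H.Walk a b, ∀ x ∈ q.support, ∃ y ∈ p.support, y.1 = x := by
  induction p with
  | @nil a => exact ⟨.nil, fun x hx => ⟨a, by simp, by simpa [eq_comm] using hx⟩⟩
  | @cons a b c hab p ih =>
    obtain ⟨q, hq⟩ := ih
    have hab' : H.Adj a b := hab
    refine ⟨.cons hab' q, fun x hx => ?_⟩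
    rw [SimpleGraph.Walk.support_cons, List.mem_cons] at hx
    rcases hx with rfl | hx
    · exact ⟨a, by simp, rfl⟩
    · obtain ⟨y, hy, rfl⟩ := hq x hx
      exact ⟨y, by simp [hy], rfl⟩

theorem SimpleGraph.preconnected_induce_iff_walk {V : Type*} {H : SimpleGraph V} {C : Set V} :
    (H.induce C).Preconnected ↔
      ∀ a ∈ C, ∀ b ∈ C, ∃ p : H.Walk a b, ∀ x ∈ p.support, x ∈ C := by
  constructor
  · intro h a ha b hb
    obtain ⟨p⟩ := h ⟨a, ha⟩ ⟨b, hb⟩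
    obtain ⟨q, hq⟩ := p.exists_walk_of_induce
    refine ⟨q, fun x hx => ?_⟩
    obtain ⟨y, -, rfl⟩ := hq x hx
    exact y.2
  · rintro h ⟨a, ha⟩ ⟨b, hb⟩
    obtain ⟨p, hp⟩ := h a ha b hb
    exact ⟨p.induce C hp⟩

/-! ### Blocks, separation vertices and connectedness of the block tree -/

section Blocks

variable {V : Type*} {H : SimpleGraph V}

theorem isSeparationVertex_iff_walk {s : V} : IsSeparationVertex H s ↔
    ∃ u v : V, u ≠ s ∧ v ≠ s ∧ H.Reachable u v ∧ ¬ ∃ p : H.Walk u v, s ∉ p.support := by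
  constructor
  · rintro ⟨⟨u, hu⟩, ⟨v, hv⟩, huv, h⟩
    refine ⟨u, v, hu, hv, huv, ?_⟩
    rintro ⟨p, hp⟩
    exact h ⟨p.induce {s}ᶜ fun x hx hxs => hp (Set.mem_singleton_iff.1 hxs ▸ hx)⟩
  · rintro ⟨u, v, hu, hv, huv, h⟩
    refine ⟨⟨u, hu⟩, ⟨v, hv⟩, huv, ?_⟩
    rintro ⟨p⟩
    obtain ⟨q, hq⟩ := p.exists_walk_of_induce
    refine h ⟨q, fun hs => ?_⟩
    obtain ⟨y, -, hy⟩ := hq s hs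
    exact y.2 hy

theorem isNonseparable_induce_iff {C : Set V} : IsNonseparable (H.induce C) ↔
    C.Nonempty ∧ (H.induce C).Preconnected ∧ ∀ s, (H.induce (C \ {s})).Preconnected := by
  constructor
  · rintro ⟨hc, hs⟩
    have hne : C.Nonempty := Set.nonempty_coe_sort.1 hc.nonempty
    refine ⟨hne, hc.preconnected, fun s => ?_⟩
    by_cases hsC : s ∈ C
    · rw [SimpleGraph.preconnected_induce_iff_walk]
      rintro a ⟨ha, has⟩ b ⟨hb, hbs⟩
      have h1 := hs ⟨s, hsC⟩
      rw [isSeparationVertex_iff_walk] at h1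
      push Not at h1
      obtain ⟨p, hp⟩ := h1 ⟨a, ha⟩ ⟨b, hb⟩ (fun h => has (congrArg Subtype.val h))
        (fun h => hbs (congrArg Subtype.val h)) (hc.preconnected _ _)
      obtain ⟨q, hq⟩ := p.exists_walk_of_induce
      refine ⟨q, fun x hx => ?_⟩
      obtain ⟨y, hy, rfl⟩ := hq x hx
      exact ⟨y.2, fun hys => hp (by rwa [show y = ⟨s, hsC⟩ from Subtype.ext hys] at hy)⟩
    · rw [Set.sdiff_singleton_eq_self hsC]
      exact hc.preconnected
  · rintro ⟨hne, hc, hs⟩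
    have : Nonempty C := hne.to_subtype
    refine ⟨⟨hc⟩, fun s => ?_⟩
    rw [isSeparationVertex_iff_walk]
    rintro ⟨u, v, hu, hv, -, h⟩
    have h1 := SimpleGraph.preconnected_induce_iff_walk.1 (hs s) u
      ⟨u.2, fun h => hu (Subtype.ext h)⟩ v ⟨v.2, fun h => hv (Subtype.ext h)⟩
    obtain ⟨p, hp⟩ := h1
    refine h ⟨p.induce C fun x hx => (hp x hx).1, fun hs => ?_⟩
    rw [SimpleGraph.Walk.support_induce] at hs
    simp only [List.mem_attachWith] at hs
    exact (hp _ hs).2 rfl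

theorem SimpleGraph.IsClique.isNonseparable_induce {C : Set V} (hC : H.IsClique C)
    (hne : C.Nonempty) : IsNonseparable (H.induce C) := by
  have key : ∀ D ⊆ C, (H.induce D).Preconnected := by
    rintro D hD ⟨a, ha⟩ ⟨b, hb⟩
    by_cases hab : a = b
    · subst hab
      rfl
    · exact SimpleGraph.Adj.reachable (hC (hD ha) (hD hb) hab)
  exact isNonseparable_induce_iff.2
    ⟨hne, key C subset_rfl, fun s => key _ Set.sdiff_subset⟩

/-- A vertex whose neighbours form a clique is not a separation vertex. -/
theorem SimpleGraph.IsClique.not_isSeparationVertex {s : V} (hs : H.IsClique (H.neighborSet s)) :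
    ¬ IsSeparationVertex H s := by
  rw [isSeparationVertex_iff_walk]
  rintro ⟨u, v, hu, hv, ⟨p⟩, h⟩
  -- The second clause makes the induction work: when the walk is at `s`, any neighbour `a` of `s`
  -- can step directly to the next vertex of the walk, since both lie in the clique.
  have key : ∀ {u v : V} (_ : H.Walk u v), v ≠ s →
      (u ≠ s → ∃ p : H.Walk u v, s ∉ p.support) ∧
      (u = s → ∀ a, H.Adj s a → ∃ p : H.Walk a v, s ∉ p.support) := by
    intro u v p hv
    induction p with
    | nil => exact ⟨fun hu => ⟨.nil, by simpa using hu.symm⟩, fun hu => absurd hu hv⟩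
    | @cons u w v huw p ih =>
      obtain ⟨ih1, ih2⟩ := ih hv
      refine ⟨fun hu => ?_, ?_⟩
      · by_cases hw : w = s
        · exact ih2 hw u (hw ▸ huw.symm)
        · obtain ⟨q, hq⟩ := ih1 hw
          exact ⟨.cons huw q, by simp [hq, hu.symm]⟩
      · rintro rfl a ha
        obtain ⟨q, hq⟩ := ih1 huw.ne'
        by_cases haw : a = w
        · subst haw
          exact ⟨q, hq⟩
        · exact ⟨.cons (hs ha huw haw) q, by simp [hq, ha.ne]⟩
  exact h ((key p hv).1 hu)

theorem exists_isBlock_superset [Finite V] {C : Set V} (hC : IsNonseparable (H.induce C)) :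
    ∃ B, IsBlock H B ∧ C ⊆ B := by
  obtain ⟨B, hB, hmax⟩ :=
    (Set.toFinite {C : Set V | IsNonseparable (H.induce C)}).exists_le_maximal hC
  exact ⟨B, hmax, hB⟩

theorem exists_isBlock_mem [Finite V] (H : SimpleGraph V) (i : V) : ∃ B, IsBlock H B ∧ i ∈ B := by
  obtain ⟨B, hB, h⟩ := exists_isBlock_superset (H := H) (C := {i})
    (SimpleGraph.IsClique.isNonseparable_induce (by simp) (by simp))
  exact ⟨B, hB, h rfl⟩

theorem SimpleGraph.Adj.exists_isBlock [Finite V] {i j : V} (h : H.Adj i j) :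
    ∃ B, IsBlock H B ∧ i ∈ B ∧ j ∈ B := by
  obtain ⟨B, hB, h⟩ := exists_isBlock_superset (H := H) (C := {i, j})
    (SimpleGraph.IsClique.isNonseparable_induce (by
      rw [SimpleGraph.isClique_pair]
      exact fun _ => h) (by simp))
  exact ⟨B, hB, h (by simp), h (by simp)⟩

theorem IsBlock.eq_of_subset {B B' : Set V} (hB : IsBlock H B) (hB' : IsBlock H B')
    (h : B ⊆ B') : B = B' :=
  h.antisymm (hB.2 hB'.1 h)

theorem IsBlock.nonempty {B : Set V} (hB : IsBlock H B) : B.Nonempty :=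
  (isNonseparable_induce_iff.1 hB.1).1

/-- The union of two nonseparable sets sharing the vertex `i` and of a path between them that
avoids `i` is nonseparable. -/
theorem isNonseparable_union_path {B B' : Set V} (hB : IsNonseparable (H.induce B))
    (hB' : IsNonseparable (H.induce B')) {i u w : V} (hi : i ∈ B) (hi' : i ∈ B') (hu : u ∈ B)
    (hw : w ∈ B') (p : H.Walk u w) (hp : p.IsPath) (hip : i ∉ p.support) :
    IsNonseparable (H.induce (B ∪ {x | x ∈ p.support} ∪ B')) := by
  classical
  obtain ⟨hne, hc, hs⟩ := isNonseparable_induce_iff.1 hB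
  obtain ⟨hne', hc', hs'⟩ := isNonseparable_induce_iff.1 hB'
  have hpc := p.connected_induce_support.preconnected
  have hui : u ≠ i := by rintro rfl; exact hip p.start_mem_support
  have hwi : w ≠ i := by rintro rfl; exact hip p.end_mem_support
  rw [isNonseparable_induce_iff]
  refine ⟨⟨i, Or.inr hi'⟩, ?_, fun s => ?_⟩
  · exact (SimpleGraph.induce_union_connected (SimpleGraph.induce_union_connected hc hpc
      ⟨u, hu, p.start_mem_support⟩).preconnected hc' ⟨i, Or.inl hi, hi'⟩).preconnected
  by_cases hsi : s = i
  · subst hsi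
    have : (B ∪ {x | x ∈ p.support} ∪ B') \ {s} =
        B \ {s} ∪ {x | x ∈ p.support} ∪ B' \ {s} := by
      rw [Set.union_sdiff_distrib, Set.union_sdiff_distrib,
        Set.sdiff_singleton_eq_self (s := {x | x ∈ p.support}) hip]
    rw [this]
    exact (SimpleGraph.induce_union_connected (SimpleGraph.induce_union_connected (hs s) hpc
      ⟨u, ⟨hu, hui⟩, p.start_mem_support⟩).preconnected (hs' s)
      ⟨w, Or.inr p.end_mem_support, hw, hwi⟩).preconnected
  set C := (B ∪ {x | x ∈ p.support} ∪ B') \ {s} with hC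
  -- As `s ≠ i`, the common vertex `i` survives the removal of `s`, and everything is joined to it.
  have h1 : ∀ y ∈ B, y ≠ s → ∃ q : H.Walk y i, ∀ x ∈ q.support, x ∈ C := by
    intro y hy hys
    obtain ⟨q, hq⟩ := SimpleGraph.preconnected_induce_iff_walk.1 (hs s) y ⟨hy, hys⟩ i
      ⟨hi, Ne.symm hsi⟩
    exact ⟨q, fun x hx => ⟨Or.inl (Or.inl (hq x hx).1), (hq x hx).2⟩⟩
  have h2 : ∀ y ∈ B', y ≠ s → ∃ q : H.Walk y i, ∀ x ∈ q.support, x ∈ C := by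
    intro y hy hys
    obtain ⟨q, hq⟩ := SimpleGraph.preconnected_induce_iff_walk.1 (hs' s) y ⟨hy, hys⟩ i
      ⟨hi', Ne.symm hsi⟩
    exact ⟨q, fun x hx => ⟨Or.inr (hq x hx).1, (hq x hx).2⟩⟩
  have h3 : ∀ y ∈ C, ∃ q : H.Walk y i, ∀ x ∈ q.support, x ∈ C := by
    rintro y ⟨(hy | hy) | hy, hys⟩
    · exact h1 y hy hys
    · have hy : y ∈ p.support := hy
      -- A path meets `s` at most once, so `s` is missing from one of the two pieces at `y`; that
      -- piece leads into `B` or `B'`.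
      by_cases hst : s ∈ (p.takeUntil y hy).support
      · have hsd : s ∉ (p.dropUntil y hy).support := by
          intro hsd
          have hnd := hp.support_nodup
          rw [← p.take_spec hy, SimpleGraph.Walk.support_append] at hnd
          rw [SimpleGraph.Walk.mem_support_iff] at hsd
          rcases hsd with rfl | hsd
          · exact hys rfl
          · exact (List.nodup_append.1 hnd).2.2 s hst s hsd rfl
        obtain ⟨q, hq⟩ := h2 w hw (by rintro rfl; exact hsd (SimpleGraph.Walk.end_mem_support _))
        refine ⟨(p.dropUntil y hy).append q, fun x hx => ?_⟩
        rw [SimpleGraph.Walk.mem_support_append_iff] at hx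
        rcases hx with hx | hx
        · exact ⟨Or.inl (Or.inr (p.support_dropUntil_subset_support hy hx)),
            by rintro rfl; exact hsd hx⟩
        · exact hq x hx
      · obtain ⟨q, hq⟩ := h1 u hu (by rintro rfl; exact hst (SimpleGraph.Walk.start_mem_support _))
        refine ⟨(p.takeUntil y hy).reverse.append q, fun x hx => ?_⟩
        rw [SimpleGraph.Walk.mem_support_append_iff, SimpleGraph.Walk.support_reverse,
          List.mem_reverse] at hx
        rcases hx with hx | hx
        · exact ⟨Or.inl (Or.inr (p.support_takeUntil_subset_support hy hx)),
            by rintro rfl; exact hst hx⟩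
        · exact hq x hx
    · exact h2 y hy hys
  rw [SimpleGraph.preconnected_induce_iff_walk]
  intro a ha b hb
  obtain ⟨q, hq⟩ := h3 a ha
  obtain ⟨q', hq'⟩ := h3 b hb
  refine ⟨q.append q'.reverse, fun x hx => ?_⟩
  rw [SimpleGraph.Walk.mem_support_append_iff, SimpleGraph.Walk.support_reverse,
    List.mem_reverse] at hx
  exact hx.elim (hq x) (hq' x)

/-- A vertex lying in two distinct blocks is a separation vertex. -/
theorem IsBlock.isSeparationVertex {B B' : Set V} (hB : IsBlock H B) (hB' : IsBlock H B')
    (hne : B ≠ B') {i : V} (hi : i ∈ B) (hi' : i ∈ B') : IsSeparationVertex H i := by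
  classical
  obtain ⟨u, hu, hu'⟩ := Set.not_subset.1 fun h => hne (hB.eq_of_subset hB' h)
  obtain ⟨w, hw, hw'⟩ := Set.not_subset.1 fun h => hne (hB'.eq_of_subset hB h).symm
  rw [isSeparationVertex_iff_walk]
  refine ⟨u, w, by rintro rfl; exact hu' hi', by rintro rfl; exact hw' hi, ?_, ?_⟩
  · have h1 := (isNonseparable_induce_iff.1 hB.1).2.1 ⟨u, hu⟩ ⟨i, hi⟩
    have h2 := (isNonseparable_induce_iff.1 hB'.1).2.1 ⟨i, hi'⟩ ⟨w, hw⟩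
    exact (h1.map (SimpleGraph.Embedding.induce B).toHom).trans
      (h2.map (SimpleGraph.Embedding.induce B').toHom)
  · rintro ⟨p, hp⟩
    -- A connection avoiding `i` would yield a nonseparable set containing `B` and `w ∉ B`, against
    -- maximality.
    have h1 := isNonseparable_union_path hB.1 hB'.1 hi hi' hu hw p.bypass p.bypass_isPath
      fun h => hp (p.support_bypass_subset_support h)
    exact hw' (hB.2 h1 (fun x hx => Or.inl (Or.inl hx)) (Or.inr hw))

theorem blockTree_reachable_of_mem {B B' : {B : Set V // IsBlock H B}} {i : V} (hi : i ∈ B.1)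
    (hi' : i ∈ B'.1) : (blockTree H).Reachable (.inl B) (.inl B') := by
  by_cases hne : B = B'
  · rw [hne]
  have hs := B.2.isSeparationVertex B'.2 (fun h => hne (Subtype.ext h)) hi hi'
  have h1 : (blockTree H).Adj (.inl B) (.inr ⟨i, hs⟩) := hi
  have h2 : (blockTree H).Adj (.inr ⟨i, hs⟩) (.inl B') := hi'
  exact h1.reachable.trans h2.reachable

/-- A walk in `H` lifts to the block tree: each edge lies in a block, and blocks of consecutive
edges share a vertex. -/
theorem SimpleGraph.Connected.blockTree [Finite V] (hH : H.Connected) :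
    (blockTree H).Connected := by
  have h1 : ∀ i j : V, H.Reachable i j → ∀ B B' : {B : Set V // IsBlock H B}, i ∈ B.1 → j ∈ B'.1 →
      (_root_.blockTree H).Reachable (.inl B) (.inl B') := by
    rintro i j ⟨p⟩
    induction p with
    | nil => exact fun B B' => blockTree_reachable_of_mem
    | cons hadj p ih =>
      intro B B' hi hj
      obtain ⟨C, hC, hiC, hjC⟩ := hadj.exists_isBlock
      exact (blockTree_reachable_of_mem (B' := ⟨C, hC⟩) hi hiC).trans (ih ⟨C, hC⟩ B' hjC hj)
  have h2 : ∀ B B' : {B : Set V // IsBlock H B},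
      (_root_.blockTree H).Reachable (.inl B) (.inl B') := by
    intro B B'
    obtain ⟨i, hi⟩ := B.2.nonempty
    obtain ⟨j, hj⟩ := B'.2.nonempty
    exact h1 i j (hH.preconnected i j) B B' hi hj
  obtain ⟨i⟩ := hH.nonempty
  obtain ⟨B₀, hB₀, -⟩ := exists_isBlock_mem H i
  have h3 : ∀ x, (_root_.blockTree H).Reachable (.inl ⟨B₀, hB₀⟩) x := by
    rintro (B | s)
    · exact h2 _ _
    · obtain ⟨B, hB, hs⟩ := exists_isBlock_mem H s.1
      have h4 : (_root_.blockTree H).Adj (.inl ⟨B, hB⟩) (.inr s) := hs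
      exact (h2 _ _).trans h4.reachable
  have : Nonempty ({B : Set V // IsBlock H B} ⊕ {s : V // IsSeparationVertex H s}) :=
    ⟨.inl ⟨B₀, hB₀⟩⟩
  exact ⟨fun x y => (h3 x).symm.trans (h3 y)⟩

end Blocks

/-! ### Blocks of the signed line graph of a tree -/

theorem Bigraph.graph_adj_iff {V : Type*} [DecidableEq V] {G : Bigraph V} {i j : V} :
    G.graph.Adj i j ↔ i ≠ j ∧ G.toMatrix i j ≠ 0 := by
  have h1 := G.one_style i j
  by_cases hij : i = j
  · subst hij
    simp
  · simp only [graph, toMatrix, Matrix.of_apply, hij, if_false, ne_eq, not_false_eq_true, true_and]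
    omega

namespace TreeModel

variable {V P : Type*} [DecidableEq V] [DecidableEq P] {G : Bigraph V} (T : TreeModel G P)

/-- The edges of the tree at the vertex `p`. -/
def star (p : P) : Set V :=
  {i | T.h i = p ∨ T.t i = p}

theorem h_mem_star (i : V) : i ∈ T.star (T.h i) := Or.inl rfl

theorem t_mem_star (i : V) : i ∈ T.star (T.t i) := Or.inr rfl

theorem h_ne_t (i : V) : T.h i ≠ T.t i := fun h => by
  simpa [h] using T.cut i i

theorem f_eq_of_mem_star {i j : V} (hij : i ≠ j) {p : P} (hj : j ∈ T.star p) :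
    T.f i (T.h j) = T.f i p := by
  have := T.cut i j
  rw [if_neg hij] at this
  rcases hj with rfl | rfl
  · rfl
  · omega

theorem f_ne {i : V} {p q : P} (hp : i ∈ T.star p) (hq : i ∈ T.star q) (hpq : p ≠ q) :
    T.f i p ≠ T.f i q := by
  have := T.cut i i
  rw [if_pos rfl] at this
  rcases hp with rfl | rfl <;> rcases hq with rfl | rfl
  · exact absurd rfl hpq
  · omega
  · omega
  · exact absurd rfl hpq

/-- There are no parallel edges: `f i` is constant along `j` but differs at the two ends of `i`. -/
theorem eq_of_mem_star {i j : V} (hij : i ≠ j) {p q : P} (hip : i ∈ T.star p) (hiq : i ∈ T.star q)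
    (hjp : j ∈ T.star p) (hjq : j ∈ T.star q) : p = q := by
  by_contra hpq
  exact T.f_ne hip hiq hpq ((T.f_eq_of_mem_star hij hjp).symm.trans (T.f_eq_of_mem_star hij hjq))

theorem toMatrix_of_h_eq_h {i j : V} (hij : i ≠ j) (h : T.h i = T.h j) : G.toMatrix i j = 1 := by
  have h1 : T.h i ≠ T.t j := h ▸ T.h_ne_t j
  have h2 : T.t i ≠ T.h j := h ▸ (T.h_ne_t i).symm
  have h3 : T.t i ≠ T.t j := fun h3 => T.h_ne_t i (T.eq_of_mem_star hij (T.h_mem_star i)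
    (T.t_mem_star i) (h ▸ T.h_mem_star j) (h3 ▸ T.t_mem_star j))
  rw [T.toMatrix_eq, edgeInner, if_pos h, if_neg h1, if_neg h2, if_neg h3]
  rfl

theorem toMatrix_of_t_eq_t {i j : V} (hij : i ≠ j) (h : T.t i = T.t j) : G.toMatrix i j = 1 := by
  have h1 : T.h i ≠ T.t j := h ▸ T.h_ne_t i
  have h2 : T.t i ≠ T.h j := h ▸ (T.h_ne_t j).symm
  have h3 : T.h i ≠ T.h j := fun h3 => T.h_ne_t i (T.eq_of_mem_star hij (T.h_mem_star i)
    (T.t_mem_star i) (h3 ▸ T.h_mem_star j) (h ▸ T.t_mem_star j))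
  rw [T.toMatrix_eq, edgeInner, if_neg h3, if_neg h1, if_neg h2, if_pos h]
  rfl

theorem toMatrix_of_h_eq_t {i j : V} (hij : i ≠ j) (h : T.h i = T.t j) : G.toMatrix i j = -1 := by
  have h1 : T.h i ≠ T.h j := h ▸ (T.h_ne_t j).symm
  have h2 : T.t i ≠ T.t j := h ▸ (T.h_ne_t i).symm
  have h3 : T.t i ≠ T.h j := fun h3 => T.h_ne_t i (T.eq_of_mem_star hij (T.h_mem_star i)
    (T.t_mem_star i) (h ▸ T.t_mem_star j) (h3 ▸ T.h_mem_star j))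
  rw [T.toMatrix_eq, edgeInner, if_neg h1, if_pos h, if_neg h2, if_neg h3]
  rfl

theorem toMatrix_of_t_eq_h {i j : V} (hij : i ≠ j) (h : T.t i = T.h j) : G.toMatrix i j = -1 := by
  rw [← G.isQuasiCartan_toMatrix.1.apply]
  exact T.toMatrix_of_h_eq_t hij.symm h.symm

theorem adj_of_mem_star {i j : V} (hij : i ≠ j) {p : P} (hi : i ∈ T.star p) (hj : j ∈ T.star p) :
    G.graph.Adj i j := by
  refine Bigraph.graph_adj_iff.2 ⟨hij, ?_⟩
  rcases hi with hi | hi <;> rcases hj with hj | hj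
  · simp [T.toMatrix_of_h_eq_h hij (hi.trans hj.symm)]
  · simp [T.toMatrix_of_h_eq_t hij (hi.trans hj.symm)]
  · simp [T.toMatrix_of_t_eq_h hij (hi.trans hj.symm)]
  · simp [T.toMatrix_of_t_eq_t hij (hi.trans hj.symm)]

theorem exists_star_of_adj {i j : V} (h : G.graph.Adj i j) :
    ∃ p, i ∈ T.star p ∧ j ∈ T.star p := by
  obtain ⟨hij, hA⟩ := Bigraph.graph_adj_iff.1 h
  by_contra! hp
  refine hA ?_
  have h1 : T.h i ≠ T.h j := fun h => hp _ (T.h_mem_star i) (h ▸ T.h_mem_star j)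
  have h2 : T.h i ≠ T.t j := fun h => hp _ (T.h_mem_star i) (h ▸ T.t_mem_star j)
  have h3 : T.t i ≠ T.h j := fun h => hp _ (T.t_mem_star i) (h ▸ T.h_mem_star j)
  have h4 : T.t i ≠ T.t j := fun h => hp _ (T.t_mem_star i) (h ▸ T.t_mem_star j)
  simp [T.toMatrix_eq, edgeInner, h1, h2, h3, h4]

theorem isClique_star (p : P) : G.graph.IsClique (T.star p) :=
  fun _ hi _ hj hij => T.adj_of_mem_star hij hi hj

/-- Consecutive edges of the walk share an end, and none of them crosses the cut defined by `i`. -/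
theorem f_eq_of_walk {i k l : V} (w : G.graph.Walk k l) (hw : i ∉ w.support) :
    T.f i (T.h k) = T.f i (T.h l) := by
  induction w with
  | nil => rfl
  | @cons a b c hab w ih =>
    rw [SimpleGraph.Walk.support_cons, List.mem_cons, not_or] at hw
    obtain ⟨p, ha, hb⟩ := T.exists_star_of_adj hab
    have hib : i ≠ b := by rintro rfl; exact hw.2 w.start_mem_support
    rw [← ih hw.2, T.f_eq_of_mem_star hw.1 ha, T.f_eq_of_mem_star hib hb]

theorem connected [Nonempty V] (T : TreeModel G P) : G.graph.Connected := by
  have key : ∀ i j, G.graph.Reachable i j := by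
    intro i j
    have h1 : ∀ {k l : V} {p : P}, k ∈ T.star p → l ∈ T.star p → G.graph.Reachable k l := by
      intro k l p hk hl
      by_cases hkl : k = l
      · rw [hkl]
      · exact (T.adj_of_mem_star hkl hk hl).reachable
    have h2 := T.connects
      (fun a b => (∃ k ∈ T.star a, G.graph.Reachable i k) ↔ ∃ k ∈ T.star b, G.graph.Reachable i k)
      ⟨fun _ => Iff.rfl, Iff.symm, Iff.trans⟩ (fun l => ?_) (T.h i) (T.h j)
    · obtain ⟨k, hk, hik⟩ := h2.1 ⟨i, T.h_mem_star i, .refl _⟩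
      exact hik.trans (h1 hk (T.h_mem_star j))
    · constructor
      · rintro ⟨k, hk, hik⟩
        exact ⟨l, T.t_mem_star l, hik.trans (h1 hk (T.h_mem_star l))⟩
      · rintro ⟨k, hk, hik⟩
        exact ⟨l, T.h_mem_star l, hik.trans (h1 hk (T.t_mem_star l))⟩
  exact ⟨fun i j => key i j⟩

/-- Otherwise `C` contains an edge `a` with ends `p ≠ q`, another edge `z` at `p`, and an edge `b`
at `q`. Deleting `a` separates `z` from `b`, as `f a` takes different values at `p` and `q`,
contrary to nonseparability. -/
theorem exists_subset_star (T : TreeModel G P) {C : Set V} (hC : IsNonseparable (G.graph.induce C)) :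
    ∃ p, C ⊆ T.star p := by
  obtain ⟨⟨i, hi⟩, hpre, hs⟩ := isNonseparable_induce_iff.1 hC
  by_cases hsub : C ⊆ {i}
  · exact ⟨T.h i, fun j hj => hsub hj ▸ T.h_mem_star i⟩
  obtain ⟨j, hj, hji⟩ := Set.not_subset.1 hsub
  by_contra! hno
  have hbd : ∀ S : Set V, ∀ a ∈ C, ∀ b ∈ C, a ∈ S → b ∉ S →
      ∃ x ∈ C, ∃ y ∈ C, x ∈ S ∧ y ∉ S ∧ G.graph.Adj x y := by
    intro S a ha b hb haS hbS
    obtain ⟨w, hw⟩ := SimpleGraph.preconnected_induce_iff_walk.1 hpre a ha b hb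
    obtain ⟨d, hd, hd1, hd2⟩ := w.exists_boundary_dart S haS hbS
    exact ⟨d.fst, hw _ (w.dart_fst_mem_support_of_mem_darts hd), d.snd,
      hw _ (w.dart_snd_mem_support_of_mem_darts hd), hd1, hd2, d.adj⟩
  obtain ⟨x, hx, i', hi', rfl, hne, hadj⟩ := hbd {i} i hi j hj rfl hji
  obtain ⟨p, hp, hp'⟩ := T.exists_star_of_adj hadj
  obtain ⟨k, hk, hkp⟩ := Set.not_subset.1 (hno p)
  obtain ⟨a, ha, b, hb, hap, hbp, hab⟩ := hbd (T.star p) x hx k hk hp hkp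
  obtain ⟨q, haq, hbq⟩ := T.exists_star_of_adj hab
  have hpq : p ≠ q := by rintro rfl; exact hbp hbq
  -- Both `x` and `i'` lie in the star of `p`, so one of them differs from `a`.
  obtain ⟨z, hz, hzp, hza⟩ : ∃ z ∈ C, z ∈ T.star p ∧ a ≠ z := by
    by_cases hax : a = x
    · exact ⟨i', hi', hp', by rw [hax]; exact Ne.symm hne⟩
    · exact ⟨x, hx, hp, hax⟩
  obtain ⟨w, hw⟩ := SimpleGraph.preconnected_induce_iff_walk.1 (hs a) z ⟨hz, Ne.symm hza⟩ b
    ⟨hb, hab.ne'⟩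
  have h1 := T.f_eq_of_walk w fun h => (hw a h).2 rfl
  rw [T.f_eq_of_mem_star hza hzp, T.f_eq_of_mem_star hab.ne hbq] at h1
  exact T.f_ne hap haq hpq h1

theorem exists_eq_star (T : TreeModel G P) {B : Set V} (hB : IsBlock G.graph B) : ∃ p, B = T.star p := by
  obtain ⟨p, hp⟩ := T.exists_subset_star hB.1
  exact ⟨p, hp.antisymm (hB.2 ((T.isClique_star p).isNonseparable_induce (hB.nonempty.mono hp)) hp)⟩

theorem isBlock_star {i j : V} (hij : i ≠ j) {p : P} (hi : i ∈ T.star p) (hj : j ∈ T.star p) :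
    IsBlock G.graph (T.star p) := by
  refine ⟨(T.isClique_star p).isNonseparable_induce ⟨i, hi⟩, fun C hC hpC => ?_⟩
  obtain ⟨q, hq⟩ := T.exists_subset_star hC
  rwa [T.eq_of_mem_star hij hi (hq (hpC hi)) hj (hq (hpC hj))]

/-- A tree edge alone at `p` has all its neighbours at its other end, where they form a clique. -/
theorem exists_ne_mem_star_of_isSeparationVertex {i : V} (hi : IsSeparationVertex G.graph i) {p : P}
    (hp : i ∈ T.star p) : ∃ j, i ≠ j ∧ j ∈ T.star p := by
  by_contra! hno
  refine SimpleGraph.IsClique.not_isSeparationVertex ?_ hi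
  obtain ⟨q, hq⟩ : ∃ q, ∀ r, i ∈ T.star r → r = p ∨ r = q := by
    rcases hp with rfl | rfl
    · exact ⟨T.t i, fun r hr => hr.imp Eq.symm Eq.symm⟩
    · exact ⟨T.h i, fun r hr => (hr.imp Eq.symm Eq.symm).symm⟩
  refine (T.isClique_star q).subset fun j hj => ?_
  have hj : G.graph.Adj i j := hj
  obtain ⟨r, hir, hjr⟩ := T.exists_star_of_adj hj
  rcases hq r hir with rfl | rfl
  · exact absurd hjr (hno j hj.ne)
  · exact hjr

theorem isBlock_star_of_isSeparationVertex {i : V} (hi : IsSeparationVertex G.graph i) {p : P}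
    (hp : i ∈ T.star p) : IsBlock G.graph (T.star p) := by
  obtain ⟨j, hij, hj⟩ := T.exists_ne_mem_star_of_isSeparationVertex hi hp
  exact T.isBlock_star hij hp hj

theorem ncard_neighborSet (T : TreeModel G P) (s : {s : V // IsSeparationVertex G.graph s}) :
    ((blockTree G.graph).neighborSet (Sum.inr s)).ncard = 2 := by
  rw [Set.ncard_eq_two]
  refine ⟨.inl ⟨_, T.isBlock_star_of_isSeparationVertex s.2 (T.h_mem_star s.1)⟩,
    .inl ⟨_, T.isBlock_star_of_isSeparationVertex s.2 (T.t_mem_star s.1)⟩, ?_, ?_⟩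
  · intro h
    obtain ⟨j, hij, hj⟩ := T.exists_ne_mem_star_of_isSeparationVertex s.2 (T.h_mem_star s.1)
    have h1 : T.star (T.h s.1) = T.star (T.t s.1) := congrArg Subtype.val (Sum.inl_injective h)
    exact T.h_ne_t s.1 (T.eq_of_mem_star hij (T.h_mem_star _) (T.t_mem_star _) hj (h1 ▸ hj))
  · ext (⟨B, hB⟩ | s')
    · simp only [SimpleGraph.mem_neighborSet, Set.mem_insert_iff, Set.mem_singleton_iff,
        Sum.inl.injEq, Subtype.mk.injEq]
      constructor
      · intro h
        have hsB : s.1 ∈ B := h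
        obtain ⟨p, rfl⟩ := T.exists_eq_star hB
        exact hsB.imp (fun h => by rw [h]) (fun h => by rw [h])
      · rintro (rfl | rfl)
        · exact T.h_mem_star s.1
        · exact T.t_mem_star s.1
    · simp [blockTree]

theorem isAcyclic (T : TreeModel G P) : (blockTree G.graph).IsAcyclic := by
  have hr : ∀ B : {B : Set V // IsBlock G.graph B}, ∃ p, B.1 = T.star p :=
    fun B => T.exists_eq_star B.2
  choose r hr using hr
  have key : ∀ (B : {B : Set V // IsBlock G.graph B}) (s : {s : V // IsSeparationVertex G.graph s}),
      s.1 ∈ B.1 → (blockTree G.graph).IsBridge s(.inl B, .inr s) := by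
    intro B s hs
    rw [SimpleGraph.isBridge_iff]
    intro hreach
    have hsr : s.1 ∈ T.star (r B) := hr B ▸ hs
    obtain ⟨q, hrq, hsq, hq⟩ : ∃ q, r B ≠ q ∧ s.1 ∈ T.star q ∧
        ∀ p, s.1 ∈ T.star p → p = r B ∨ p = q := by
      rcases hsr with h | h
      · exact ⟨T.t s.1, h ▸ T.h_ne_t s.1, T.t_mem_star _,
          fun p hp => hp.imp (fun h' => h'.symm.trans h) Eq.symm⟩
      · exact ⟨T.h s.1, h ▸ (T.h_ne_t s.1).symm, T.h_mem_star _,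
          fun p hp => (hp.imp Eq.symm (fun h' => h'.symm.trans h)).symm⟩
    -- The cut function of `s` carried over to the block tree. Giving `s` the value at its other end
    -- `q` makes the edge from `B` to `s` the only one across which `φ` can change.
    let φ : {B : Set V // IsBlock G.graph B} ⊕ {s : V // IsSeparationVertex G.graph s} → ℤ :=
      Sum.elim (fun C => T.f s.1 (r C))
        (fun x => if x = s then T.f s.1 q else T.f s.1 (T.h x.1))
    have hφ : ∀ (C : {B : Set V // IsBlock G.graph B})
        (x : {s : V // IsSeparationVertex G.graph s}), x.1 ∈ C.1 →
        ¬ (C = B ∧ x = s) → φ (.inl C) = φ (.inr x) := by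
      intro C x hx hne
      have hxr : x.1 ∈ T.star (r C) := hr C ▸ hx
      simp only [φ, Sum.elim_inl, Sum.elim_inr]
      split_ifs with hxs
      · subst hxs
        rcases hq _ hxr with h | h
        · exact absurd ⟨Subtype.ext (by rw [hr C, hr B, h]), rfl⟩ hne
        · rw [h]
      · exact (T.f_eq_of_mem_star (fun h => hxs (Subtype.ext h.symm)) hxr).symm
    have h1 := hreach.apply_eq (φ := φ) (by
      rintro (C | x) (D | y) h
      · exact absurd h.1 (by simp [blockTree])
      · refine hφ C y h.1 ?_
        rintro ⟨rfl, rfl⟩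
        simp at h
      · refine (hφ D x h.1 ?_).symm
        rintro ⟨rfl, rfl⟩
        simp at h
      · exact absurd h.1 (by simp [blockTree]))
    simp only [φ, Sum.elim_inl, Sum.elim_inr, if_true] at h1
    exact T.f_ne hsr hsq hrq h1
  rw [SimpleGraph.isAcyclic_iff_forall_adj_isBridge]
  rintro (B | s) (C | x) h
  · exact h.elim
  · exact key B x h
  · rw [Sym2.eq_swap]
    exact key C s h
  · exact h.elim

theorem exists_eq_complete (T : TreeModel G P) {B : Set V} (hB : IsBlock G.graph B) :
    ∃ (X Y : Set B) (h : IsCompl X Y), G.induce B = Bigraph.complete X Y h := by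
  obtain ⟨p, rfl⟩ := T.exists_eq_star hB
  have hX : ∀ i : T.star p, T.h i.1 ≠ p → T.t i.1 = p := fun i hi => i.2.resolve_left hi
  refine ⟨{i | T.h i.1 = p}, {i | T.h i.1 ≠ p}, isCompl_compl, ?_⟩
  have key : ∀ i j : T.star p, i ≠ j → G.toMatrix i j =
      if (T.h i.1 = p ↔ T.h j.1 = p) then 1 else -1 := by
    intro i j hij
    have hij : i.1 ≠ j.1 := fun h => hij (Subtype.ext h)
    by_cases hi : T.h i.1 = p <;> by_cases hj : T.h j.1 = p
    · simp [hi, hj, T.toMatrix_of_h_eq_h hij (hi.trans hj.symm)]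
    · simp [hi, hj, T.toMatrix_of_h_eq_t hij (hi.trans (hX j hj).symm)]
    · simp [hi, hj, T.toMatrix_of_t_eq_h hij ((hX i hi).trans hj.symm)]
    · simp [hi, hj, T.toMatrix_of_t_eq_t hij ((hX i hi).trans (hX j hj).symm)]
  have hboth : ∀ i j : T.star p, i ≠ j →
      G.solid i j = (if (T.h i.1 = p ↔ T.h j.1 = p) then 0 else 1) ∧
      G.dotted i j = (if (T.h i.1 = p ↔ T.h j.1 = p) then 1 else 0) := by
    intro i j hij
    have h1 := key i j hij
    have h2 := G.one_style i j
    simp only [Bigraph.toMatrix, Matrix.of_apply] at h1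
    split_ifs at h1 ⊢ <;> omega
  ext i j
  · by_cases hij : i = j
    · subst hij
      simp [Bigraph.solid_loopless]
    · simp only [Bigraph.induce, Bigraph.complete, (hboth i j hij).1, Set.mem_ofPred_eq]
      by_cases hi : T.h i.1 = p <;> by_cases hj : T.h j.1 = p <;> simp [hi, hj]
  · by_cases hij : i = j
    · subst hij
      simp [Bigraph.dotted_loopless]
    · simp only [Bigraph.induce, Bigraph.complete, (hboth i j hij).2, Set.mem_ofPred_eq]
      by_cases hi : T.h i.1 = p <;> by_cases hj : T.h j.1 = p <;> simp [hi, hj, hij]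

theorem isABlockTree [Finite V] [Nonempty V] (T : TreeModel G P) : G.IsABlockTree :=
  ⟨⟨T.connected.blockTree, T.isAcyclic⟩, fun _ hB => T.exists_eq_complete hB, T.ncard_neighborSet⟩

end TreeModel

/-! ### Recovering the oriented tree from an 𝔸-block tree -/

/-- Every assignment of signs to the edges of a tree is a coboundary. -/
theorem SimpleGraph.IsTree.exists_sign {W : Type*} {H : SimpleGraph W} (hH : H.IsTree)
    (c : W → W → ℤˣ) (hc : ∀ x y, c x y = c y x) :
    ∃ ε : W → ℤˣ, ∀ x y, H.Adj x y → ε x * ε y = c x y := by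
  obtain ⟨r⟩ := hH.1.nonempty
  choose p hp _ using hH.existsUnique_path r
  -- The product of the signs along the path from the root; of the root paths of two adjacent
  -- vertices, one extends the other.
  let ε : W → ℤˣ := fun x => ((p x).darts.map fun d => c d.fst d.snd).prod
  have key : ∀ x y, H.Adj x y → x ∈ (p y).support → ε x * ε y = c x y := by
    intro x y hxy hx
    have h1 := hH.2.path_concat (hp x) (hp y) hxy hx
    have h2 : ε y = ε x * c x y := by
      simp only [ε]
      rw [h1]
      simp [SimpleGraph.Walk.darts_concat]
    rw [h2, ← mul_assoc, Int.units_mul_self, one_mul]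
  refine ⟨ε, fun x y hxy => ?_⟩
  by_cases hx : x ∈ (p y).support
  · exact key x y hxy hx
  · have hy := hH.2.mem_support_of_ne_mem_support_of_adj_of_isPath (hp x) (hp y) hxy hx
    rw [mul_comm, hc]
    exact key y x hxy.symm hy

/-- Two distinct blocks share at most one vertex. -/
theorem IsBlock.eq_of_mem {V : Type*} {H : SimpleGraph V} {B B' : Set V} (hB : IsBlock H B)
    (hB' : IsBlock H B') {i j : V} (hij : i ≠ j) (hi : i ∈ B) (hi' : i ∈ B') (hj : j ∈ B)
    (hj' : j ∈ B') : B = B' := by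
  -- The trivial path at `j` joins the blocks away from `i`, so `B ∪ B'` is nonseparable.
  have h1 := isNonseparable_union_path hB.1 hB'.1 hi hi' hj hj' .nil (by simp) (by simpa using hij)
  have h2 : B ⊆ B ∪ {x | x ∈ (SimpleGraph.Walk.nil : H.Walk j j).support} ∪ B' :=
    fun x hx => Or.inl (Or.inl hx)
  exact (hB'.eq_of_subset hB fun x hx => hB.2 h1 h2 (Or.inr hx)).symm

/-- Count the edges of the block tree twice: as two per separation vertex, and as one less than its
number of vertices. -/
theorem card_block_eq {V : Type*} [Finite V] {H : SimpleGraph V} (hT : (blockTree H).IsTree)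
    (hd : ∀ s : {s : V // IsSeparationVertex H s},
      ((blockTree H).neighborSet (Sum.inr s)).ncard = 2) :
    Nat.card {B : Set V // IsBlock H B} = Nat.card {s : V // IsSeparationVertex H s} + 1 := by
  classical
  have := Fintype.ofFinite V
  have := Fintype.ofFinite {B : Set V // IsBlock H B}
  have := Fintype.ofFinite {s : V // IsSeparationVertex H s}
  have h1 := hT.card_edgeFinset
  have hbip : (blockTree H).IsBipartiteWith
      ↑(Finset.univ.map (Function.Embedding.inl : _ ↪ {B : Set V // IsBlock H B} ⊕
        {s : V // IsSeparationVertex H s}))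
      ↑(Finset.univ.map (Function.Embedding.inr : _ ↪ {B : Set V // IsBlock H B} ⊕
        {s : V // IsSeparationVertex H s})) := by
    constructor
    · rw [Set.disjoint_left]
      rintro (x | x) <;> simp
    · rintro (x | x) (y | y) h
      · exact h.elim
      · simp
      · simp
      · exact h.elim
  have h2 := SimpleGraph.isBipartiteWith_sum_degrees_eq_card_edges' hbip
  have h3 : ∀ s : {s : V // IsSeparationVertex H s}, (blockTree H).degree (Sum.inr s) = 2 := by
    intro s
    rw [← hd s, Set.ncard_eq_toFinset_card', ← SimpleGraph.card_neighborSet_eq_degree,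
      Set.toFinset_card]
  rw [Finset.sum_map] at h2
  rw [Finset.sum_congr rfl fun s _ => (by convert h3 s; rfl : _ = 2), Finset.sum_const,
    Finset.card_univ, smul_eq_mul] at h2
  rw [Fintype.card_sum] at h1
  rw [Nat.card_eq_fintype_card, Nat.card_eq_fintype_card]
  omega

namespace Bigraph

variable {V : Type*} {G : Bigraph V}

theorem exists_sign_of_induce_eq_complete [DecidableEq V] {B : Set V} {X Y : Set B} {h : IsCompl X Y}
    (hB : G.induce B = complete X Y h) :
    ∃ τ : V → ℤˣ, ∀ i ∈ B, ∀ j ∈ B, i ≠ j → G.toMatrix i j = ((τ i * τ j : ℤˣ) : ℤ) := by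
  classical
  refine ⟨fun i => if ∃ hi : i ∈ B, (⟨i, hi⟩ : B) ∈ X then 1 else -1, fun i hi j hj hij => ?_⟩
  have hs : G.solid i j = (complete X Y h).solid ⟨i, hi⟩ ⟨j, hj⟩ := by rw [← hB]; rfl
  have hd : G.dotted i j = (complete X Y h).dotted ⟨i, hi⟩ ⟨j, hj⟩ := by rw [← hB]; rfl
  have hY : ∀ x : B, x ∈ Y ↔ x ∉ X := fun x => by rw [← h.compl_eq]; rfl
  simp only [toMatrix, Matrix.of_apply, hij, if_false, hs, hd, complete, hY]
  by_cases h1 : (⟨i, hi⟩ : B) ∈ X <;> by_cases h2 : (⟨j, hj⟩ : B) ∈ X <;>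
    simp [h1, h2, hi, hj, hij]

/-- For each vertex `i` a block `b i` containing it and a second end `o i`, which is the other
block at `i` if there is one, and a leaf otherwise. -/
theorem exists_block_ends {H : SimpleGraph V} [Finite V]
    (hd : ∀ s : {s : V // IsSeparationVertex H s},
      ((blockTree H).neighborSet (Sum.inr s)).ncard = 2) (i : V) :
    ∃ (b : {B : Set V // IsBlock H B})
      (o : {B : Set V // IsBlock H B} ⊕ {s : V // ¬ IsSeparationVertex H s}),
      i ∈ b.1 ∧ (∀ C, o = .inl C → i ∈ C.1 ∧ C ≠ b) ∧ (∀ k, o = .inr k → k.1 = i) ∧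
      (∀ C : {B : Set V // IsBlock H B}, i ∈ C.1 → C = b ∨ o = .inl C) ∧
      (∀ hi : ¬ IsSeparationVertex H i, o = .inr ⟨i, hi⟩) := by
  by_cases hi : IsSeparationVertex H i
  · obtain ⟨x, y, hxy, h⟩ := Set.ncard_eq_two.1 (hd ⟨i, hi⟩)
    have hx : (blockTree H).Adj (.inr ⟨i, hi⟩) x :=
      (SimpleGraph.mem_neighborSet _ _ _).1 (by rw [h]; simp)
    have hy : (blockTree H).Adj (.inr ⟨i, hi⟩) y :=
      (SimpleGraph.mem_neighborSet _ _ _).1 (by rw [h]; simp)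
    rcases x with B | x
    · rcases y with C | y
      · refine ⟨B, .inl C, hx, ?_, by simp, ?_, fun h => absurd hi h⟩
        · rintro D hD
          obtain rfl := Sum.inl_injective hD
          exact ⟨hy, fun h => hxy (by rw [h])⟩
        · intro D hD
          have hD' : (Sum.inl D : {B : Set V // IsBlock H B} ⊕ {s : V // IsSeparationVertex H s}) ∈
              (blockTree H).neighborSet (.inr ⟨i, hi⟩) := hD
          rw [h] at hD'
          rcases hD' with hD' | hD'
          · exact Or.inl (Sum.inl_injective hD')
          · exact Or.inr (congrArg _ (Sum.inl_injective hD').symm)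
      · exact hy.elim
    · exact hx.elim
  · obtain ⟨B, hB, hiB⟩ := exists_isBlock_mem H i
    refine ⟨⟨B, hB⟩, .inr ⟨i, hi⟩, hiB, by simp, ?_, ?_, fun _ => rfl⟩
    · rintro k hk
      rw [← Sum.inr_injective hk]
    · rintro ⟨C, hC⟩ hiC
      left
      by_contra hne
      exact hi (hC.isSeparationVertex hB (fun h => hne (Subtype.ext h)) hiC hiB)

/-- The inner product of two edges given by unoriented ends `a`, `o` and orientations `δ`. -/
theorem edgeInner_orient {P : Type*} [DecidableEq P] (a o : V → P) (δ : V → ℤˣ) (i j : V) :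
    edgeInner (fun i => if δ i = 1 then a i else o i) (fun i => if δ i = 1 then o i else a i) i j =
      ((δ i * δ j : ℤˣ) : ℤ) * edgeInner a o i j := by
  rcases Int.units_eq_one_or (δ i) with hi | hi <;> rcases Int.units_eq_one_or (δ j) with hj | hj <;>
    simp [edgeInner, hi, hj] <;> ring

/-- The vertex `i` becomes the vector `δ i` times $e_{b(i)}-e_{o(i)}$. Its coefficient at each block
`B` containing `i` must be `ε B * τ B i`, so the two blocks at a separation vertex have to give
opposite signs. -/
theorem IsABlockTree.exists_connects [DecidableEq V] [Finite V] (hG : G.IsABlockTree) :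
    ∃ h t : V → {B : Set V // IsBlock G.graph B} ⊕ {s : V // ¬ IsSeparationVertex G.graph s},
      Connects h t ∧ ∀ [DecidableEq ({B : Set V // IsBlock G.graph B} ⊕
        {s : V // ¬ IsSeparationVertex G.graph s})], ∀ i j, G.toMatrix i j = edgeInner h t i j := by
  classical
  obtain ⟨hT, hF, hd⟩ := hG
  have hτ : ∀ B : {B : Set V // IsBlock G.graph B}, ∃ τ : V → ℤˣ, ∀ i ∈ B.1, ∀ j ∈ B.1, i ≠ j →
      G.toMatrix i j = ((τ i * τ j : ℤˣ) : ℤ) := by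
    intro B
    obtain ⟨X, Y, h, hB⟩ := hF B.1 B.2
    exact exists_sign_of_induce_eq_complete hB
  choose τ hτ using hτ
  choose b o hb ho ho' hcov hleaf using exists_block_ends hd
  -- With an auxiliary sign at each separation vertex `s`, the opposite-sign condition becomes one
  -- equation per edge of the block tree; the minus sign marks the second block at `s`.
  let c : {B : Set V // IsBlock G.graph B} → V → ℤˣ :=
    fun B s => if B = b s then τ B s else - τ B s
  obtain ⟨ε, hε⟩ := hT.exists_sign (fun x y => match x, y with
    | .inl B, .inr s => c B s.1
    | .inr s, .inl B => c B s.1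
    | _, _ => 1) (by rintro (B | s) (C | t) <;> rfl)
  let δ : V → ℤˣ := fun i => ε (.inl (b i)) * τ (b i) i
  have hδ : ∀ i C, o i = .inl C → δ i = - (ε (.inl C) * τ C i) := by
    intro i C hC
    have hs := C.2.isSeparationVertex (b i).2
      (fun h => (ho i C hC).2 (Subtype.ext h)) (ho i C hC).1 (hb i)
    have h1 := hε (.inl (b i)) (.inr ⟨i, hs⟩) (hb i)
    have h2 := hε (.inl C) (.inr ⟨i, hs⟩) (ho i C hC).1
    simp only [c, if_true, if_neg (ho i C hC).2] at h1 h2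
    have h3 : τ C i = - (ε (.inl C) * ε (.inr ⟨i, hs⟩)) := by rw [h2, neg_neg]
    simp only [δ]
    rw [← h1, h3, ← mul_assoc, Int.units_mul_self, mul_neg, ← mul_assoc, Int.units_mul_self,
      neg_neg]
  refine ⟨fun i => if δ i = 1 then .inl (b i) else o i,
    fun i => if δ i = 1 then o i else .inl (b i), ?_, ?_⟩
  · intro r hr hrel
    have hbo : ∀ i, r (.inl (b i)) (o i) := by
      intro i
      have h1 := hrel i
      by_cases hi : δ i = 1
      · simpa [hi] using h1
      · exact hr.symm (by simpa [hi] using h1)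
    have hmem : ∀ (B : {B : Set V // IsBlock G.graph B}) (i : V), i ∈ B.1 →
        r (.inl B) (.inl (b i)) := by
      intro B i hi
      rcases hcov i B hi with rfl | h
      · exact hr.refl _
      · exact hr.symm (h ▸ hbo i)
    -- Collapsing each separation vertex onto its chosen block carries adjacency in the block tree
    -- to the relation `r`.
    let m : {B : Set V // IsBlock G.graph B} ⊕ {s : V // IsSeparationVertex G.graph s} →
      {B : Set V // IsBlock G.graph B} := Sum.elim id (fun s => b s.1)
    have hblocks : ∀ B C : {B : Set V // IsBlock G.graph B}, r (.inl B) (.inl C) := by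
      intro B C
      have h1 := (hT.1.preconnected (.inl B) (.inl C)).apply_eq
        (φ := fun x => r (.inl B) (.inl (m x))) (by
          have h2 : ∀ x y, (blockTree G.graph).Adj x y → r (.inl (m x)) (.inl (m y)) := by
            rintro (D | s) (E | s') h
            · exact h.elim
            · exact hmem D s' h
            · exact hr.symm (hmem E s h)
            · exact h.elim
          exact fun x y h => propext
            ⟨fun h' => hr.trans h' (h2 x y h), fun h' => hr.trans h' (hr.symm (h2 x y h))⟩)
      exact h1.mp (hr.refl _)
    have hto : ∀ x, ∃ B, r x (.inl B) := by
      rintro (B | s)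
      · exact ⟨B, hr.refl _⟩
      · exact ⟨b s.1, hr.symm (hleaf s.1 s.2 ▸ hbo s.1)⟩
    intro x y
    obtain ⟨B, hB⟩ := hto x
    obtain ⟨C, hC⟩ := hto y
    exact hr.trans hB (hr.trans (hblocks B C) (hr.symm hC))
  · intro inst i j
    rw [edgeInner_orient (fun i => .inl (b i)) o δ]
    have hne : ∀ i, .inl (b i) ≠ o i := fun i h => (ho i _ h.symm).2 rfl
    by_cases hij : i = j
    · subst hij
      rw [G.isQuasiCartan_toMatrix.2, Int.units_mul_self]
      simp [edgeInner, hne, (hne i).symm]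
    have huniq : ∀ B C : {B : Set V // IsBlock G.graph B}, i ∈ B.1 → j ∈ B.1 → i ∈ C.1 →
        j ∈ C.1 → B = C :=
      fun B C h1 h2 h3 h4 => Subtype.ext (B.2.eq_of_mem C.2 hij h1 h3 h2 h4)
    have hval : ∀ B : {B : Set V // IsBlock G.graph B}, i ∈ B.1 → j ∈ B.1 → G.toMatrix i j =
        (((ε (.inl B) * τ B i) * (ε (.inl B) * τ B j) : ℤˣ) : ℤ) := by
      intro B hi hj
      rw [hτ B i hi j hj hij, mul_mul_mul_comm, Int.units_mul_self, one_mul]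
    by_cases hcom : ∃ B : {B : Set V // IsBlock G.graph B}, i ∈ B.1 ∧ j ∈ B.1
    · obtain ⟨B, hi, hj⟩ := hcom
      rw [hval B hi hj]
      -- The shared block is the first or second end of each edge, with coefficient `δ` or `-δ`
      -- there; the other ends do not meet.
      rcases hcov i B hi with h1 | h1 <;> rcases hcov j B hj with h2 | h2
      · have e1 : b i = b j := h1.symm.trans h2
        have e2 : .inl (b i) ≠ o j := e1 ▸ hne j
        have e3 : o i ≠ .inl (b j) := e1 ▸ (hne i).symm
        have e4 : o i ≠ o j := by
          intro h
          rcases hoi : o i with C | k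
          · obtain ⟨hiC, hCb⟩ := ho i C hoi
            exact hCb ((huniq C B hiC (ho j C (h ▸ hoi)).1 hi hj).trans h1)
          · exact hij ((ho' i k hoi).symm.trans (ho' j k (h ▸ hoi)))
        have d1 : ε (.inl B) * τ B i = δ i := by rw [h1]
        have d2 : ε (.inl B) * τ B j = δ j := by rw [h2]
        rw [d1, d2]
        simp [edgeInner, e1, e4, hne j, e3]
      · have d1 : ε (.inl B) * τ B i = δ i := by rw [h1]
        have d2 : ε (.inl B) * τ B j = - δ j := by rw [hδ j B h2, neg_neg]
        have e2 : .inl (b i) = o j := by rw [h2, h1]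
        have e1 : b i ≠ b j := fun h => hne j (h ▸ e2)
        have e4 : o i ≠ o j := fun h => hne i (e2.trans h.symm)
        have e3 : o i ≠ .inl (b j) := by
          intro h
          obtain ⟨h3, h4⟩ := ho i _ h
          exact h4 ((huniq _ B h3 (hb j) hi hj).trans h1)
        rw [d1, d2]
        simp [edgeInner, e2, e3, e4, (hne j).symm]
      · have d1 : ε (.inl B) * τ B i = - δ i := by rw [hδ i B h1, neg_neg]
        have d2 : ε (.inl B) * τ B j = δ j := by rw [h2]
        have e3 : o i = .inl (b j) := by rw [h1, h2]
        have e1 : b i ≠ b j := fun h => hne i (h ▸ e3.symm)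
        have e4 : o i ≠ o j := fun h => hne j (e3.symm.trans h)
        have e2 : .inl (b i) ≠ o j := by
          intro h
          obtain ⟨h3, h4⟩ := ho j _ h.symm
          exact h4 ((huniq _ B (hb i) h3 hi hj).trans h2)
        rw [d1, d2]
        simp [edgeInner, e1, e2, e3, hne j]
      · have d1 : ε (.inl B) * τ B i = - δ i := by rw [hδ i B h1, neg_neg]
        have d2 : ε (.inl B) * τ B j = - δ j := by rw [hδ j B h2, neg_neg]
        have e4 : o i = o j := h1.trans h2.symm
        have e2 : .inl (b i) ≠ o j := e4 ▸ hne i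
        have e3 : .inl (b j) ≠ o j := hne j
        have e1 : b i ≠ b j := by
          intro h
          exact (ho i B h1).2 (huniq B (b i) hi hj (hb i) (h ▸ hb j))
        rw [d1, d2]
        simp [edgeInner, e1, e2, e4, e3.symm]
    · have h0 : G.toMatrix i j = 0 := by
        by_contra hA
        obtain ⟨B, hB, hi, hj⟩ := (graph_adj_iff.2 ⟨hij, hA⟩).exists_isBlock
        exact hcom ⟨⟨B, hB⟩, hi, hj⟩
      have e1 : b i ≠ b j := fun h => hcom ⟨b i, hb i, h ▸ hb j⟩
      have e2 : .inl (b i) ≠ o j := fun h => hcom ⟨b i, hb i, (ho j _ h.symm).1⟩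
      have e3 : o i ≠ .inl (b j) := fun h => hcom ⟨b j, (ho i _ h).1, hb j⟩
      have e4 : o i ≠ o j := by
        intro h
        rcases hoi : o i with C | k
        · exact hcom ⟨C, (ho i C hoi).1, (ho j C (h ▸ hoi)).1⟩
        · exact hij ((ho' i k hoi).symm.trans (ho' j k (h ▸ hoi)))
      simp [h0, edgeInner, e1, e2, e3, e4]

theorem IsABlockTree.hasDynkinType {n : ℕ} {G : Bigraph (Fin n)} (hG : G.IsABlockTree) :
    G.HasDynkinType (CartanMatrix.A n) := by
  classical
  obtain ⟨h, t, hc, hA⟩ := hG.exists_connects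
  -- Blocks exceed separation vertices by one, and the leaves make up the remaining vertices of `G`.
  have hcard : Nat.card ({B : Set (Fin n) // IsBlock G.graph B} ⊕
      {s : Fin n // ¬ IsSeparationVertex G.graph s}) = n + 1 := by
    have h1 := card_block_eq hG.1 hG.2.2
    have h2 := Nat.card_congr (Equiv.sumCompl fun s => IsSeparationVertex G.graph s)
    rw [Nat.card_sum, Nat.card_fin] at h2
    rw [Nat.card_sum]
    omega
  let e := Finite.equivFinOfCardEq hcard
  refine hasDynkinType_of_connects (hc.comp_equiv e) fun i j => ?_
  rw [hA]
  simp [edgeInner]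

end Bigraph

theorem mainTheorem1 (n : ℕ) (hn : 1 ≤ n) (G : Bigraph (Fin n)) :
    G.HasDynkinType (CartanMatrix.A n) ↔ G.IsABlockTree := by
  -- For $n=0$ the block tree is empty, hence not a tree.
  have : Nonempty (Fin n) := ⟨⟨0, hn⟩⟩
  refine ⟨fun h => ?_, fun h => h.hasDynkinType⟩
  obtain ⟨T⟩ := h.nonempty_treeModel
  exact T.isABlockTree
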